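/- **Setting.** Let $\Phi(z)=\mathbb P(Z\ge z)$, $Z\sim\mathcal N(0,1)$, be the standard Gaussian upper-tail function, and let $\mu>0$ and $\pi_0\in(0,1)$. For each $m$ let $\tau^{(m)}\in\{0,\mu\}^m$ with $m_0(m)=|\{i:\tau^{(m)}_i=0\}|=\lfloor m\pi_0\rfloor$, let $Y^{(m)}_1,\dots,Y^{(m)}_m$ be real random variables on a probability space (with arbitrary joint law; for instance an exchangeable Gaussian vector with mean $0$, variance $1$ and correlation $\rho_m$), and let $p_i=\Phi(\tau^{(m)}_i+Y^{(m)}_i)$. For $t\in[0,1]$ put $G_0(t)=t$, $G_1(t)=\Phi(\Phi^{-1}(t)-\mu)$ (with $G_1(0)=0$, $G_1(1)=1$), $G=\pi_0G_0+(1-\pi_0)G_1$, $$\widehat{\mathbb G}_{0,m}(t)=\frac1{m_0(m)}\sum_{i:\tau_i=0}\mathbf 1\{p_i\le t\},\qquad \widehat{\mathbb G}_{1,m}(t)=\frac1{m-m_0(m)}\sum_{i:\tau_i>0}\mathbf 1\{p_i\le t\},\qquad \widehat{\mathbb G}_{m}(t)=\frac1m\sum_{i=1}^m\mathbf 1\{p_i\le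 t\},$$ $$\mathrm{FDP}_m(t)=\frac{|\{i:\tau_i=0,\ p_i\le t\}|}{|\{i:p_i\le t\}|\vee 1}.$$ (A fraction with denominator $0$, which occurs for finitely many $m$ only, is read as $0$.) Let $D(0,1)$ be the space of right-continuous functions $[0,1]\to\mathbb R$ with left-hand limits and $C(0,1)$ the space of continuous functions $[0,1]\to\mathbb R$. A map $\mathcal T:D(0,1)\to[0,1]$ is Hadamard differentiable at $G$ tangentially to $C(0,1)$, with derivative the continuous linear form $\dot{\mathcal T}_G$ on $C(0,1)$ (for the sup norm), if $(\mathcal T(G+s_nh_n)-\mathcal T(G))/s_n\to\dot{\mathcal T}_G(H)$ whenever $s_n\downarrow0$ ($s_n>0$, $s_n \to 0$), $h_n\in D(0,1)$ and $h_n\to H\in C(0,1)$ uniformly. **Proposition.** Let $\mathcal T:D(0,1)\to[0,1]$ be Hadamard differentiable at $G$ tangentially to $C(0,1)$, with derivative $\dot{\mathcal T}_G$, and such that every $\mathcal T(\widehat{\mathbb G}_m)$ is a random variable. Let $q(t)=\pi_0t/G(t)$ for $t\in(0,1]$, let $t^\star=\mathcal T(G)$ and assume $t^\star>0$. Let $\dot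 q(t^\star)$ be the derivative of $q$ at $t^\star$ (one-sided if $t^\star=1$), and let $\zeta_0,\zeta_1$ be the continuous linear forms on $C(0,1)$ $$\zeta_0=\frac{q(t^\star)(1-q(t^\star))}{t^\star}\,\delta_{t^\star}+\dot q(t^\star)\,\pi_0\,\dot{\mathcal T}_G,\qquad \zeta_1=-\frac{q(t^\star)(1-q(t^\star))}{G_1(t^\star)}\,\delta_{t^\star}+\dot q(t^\star)(1-\pi_0)\,\dot{\mathcal T}_G .$$ Let $a_m\to\infty$ with $a_m=o(m)$, and let $W_0,W_1$ be processes with continuous paths, defined on a common probability space, such that $$a_m\big(\widehat{\mathbb G}_{0,m}-G_0,\ \widehat{\mathbb G}_{1,m}-G_1\big)\ \longrightarrow\ (W_0,W_1)$$ in distribution in $D(0,1)\times D(0,1)$ with the product of the Skorokhod (J1) topologies. Then $$a_m\big(\mathrm{FDP}_m(\mathcal T(\widehat{\mathbb G}_m))-q(t^\star)\big)\ \longrightarrow\ \zeta_0(W_0)+\zeta_1(W_1)\qquad\text{in distribution.}$$ -/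

import Mathlib

open MeasureTheory ProbabilityTheory Filter Topology Set
open scoped unitInterval ENNReal

noncomputable section

/-! ### The Skorokhod space `D(0,1)` -/

/-- A function on `[0,1]` is càdlàg if it is right-continuous with left-hand limits. -/
def IsCadlag (f : I → ℝ) : Prop :=
  ∀ t : I, ContinuousWithinAt f (Ici t) t ∧ ∃ l : ℝ, Tendsto f (𝓝[<] t) (𝓝 l)

/-- The càdlàg functions, as a linear subspace of all functions `[0,1] → ℝ`. -/
def cadlagSubmodule : Submodule ℝ (I → ℝ) where
  carrier := {f | IsCadlag f}
  zero_mem' := fun _ => ⟨continuousWithinAt_const, 0, tendsto_const_nhds⟩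
  add_mem' := fun {f g} hf hg t => by
    obtain ⟨hf1, l, hl⟩ := hf t
    obtain ⟨hg1, k, hk⟩ := hg t
    exact ⟨hf1.add hg1, l + k, hl.add hk⟩
  smul_mem' := fun c f hf t => by
    obtain ⟨hf1, l, hl⟩ := hf t
    exact ⟨hf1.const_smul c, c • l, hl.const_smul c⟩

/-- The space `D(0,1)` of càdlàg functions `[0,1] → ℝ`. (It is a type of its own, so that it does
not inherit the topology of pointwise convergence.) -/
def SkorokhodD : Type := cadlagSubmodule

namespace SkorokhodD

instance : AddCommGroup SkorokhodD := inferInstanceAs (AddCommGroup cadlagSubmodule)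

instance : Module ℝ SkorokhodD := inferInstanceAs (Module ℝ cadlagSubmodule)

instance : CoeFun SkorokhodD (fun _ => I → ℝ) := ⟨fun f => f.1⟩

/-- The element of `D(0,1)` given by a càdlàg function. -/
def mk (f : I → ℝ) (hf : IsCadlag f) : SkorokhodD := ⟨f, hf⟩

@[simp] theorem mk_apply (f : I → ℝ) (hf : IsCadlag f) (t : I) : mk f hf t = f t := rfl

@[simp] theorem add_apply (f g : SkorokhodD) (t : I) : (f + g) t = f t + g t := rfl

@[simp] theorem sub_apply (f g : SkorokhodD) (t : I) : (f - g) t = f t - g t := rfl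

@[simp] theorem smul_apply (c : ℝ) (f : SkorokhodD) (t : I) : (c • f) t = c * f t := rfl

/-- The inclusion of `C(0,1)` in `D(0,1)`. -/
def ofContinuous (f : C(I, ℝ)) : SkorokhodD :=
  mk f fun t => ⟨f.continuous.continuousWithinAt,
    f t, f.continuous.continuousAt.tendsto.mono_left nhdsWithin_le_nhds⟩

/-- Skorokhod's (J1) distance: the infimum, over the increasing bijections `lam` of `[0,1]`, of
`max (sup_t |lam t - t|) (sup_t |f t - g (lam t)|)`. -/
def skorokhodEDist (f g : SkorokhodD) : ℝ≥0∞ :=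
  ⨅ lam : I ≃o I, max (⨆ t : I, edist (lam t) t) (⨆ t : I, edist (f t) (g (lam t)))

theorem skorokhodEDist_comm_le (f g : SkorokhodD) :
    skorokhodEDist f g ≤ skorokhodEDist g f := by
  refine le_iInf fun lam => (iInf_le _ lam.symm).trans (max_le_max ?_ ?_)
  · refine iSup_le fun t => le_iSup_of_le (lam.symm t) ?_
    rw [OrderIso.apply_symm_apply, edist_comm]
  · refine iSup_le fun t => le_iSup_of_le (lam.symm t) ?_
    rw [OrderIso.apply_symm_apply, edist_comm]

/-- The Skorokhod topology on `D(0,1)`. -/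
instance : PseudoEMetricSpace SkorokhodD where
  edist := skorokhodEDist
  edist_self f := by
    refine le_antisymm ((iInf_le _ (OrderIso.refl I)).trans ?_) bot_le
    simp
  edist_comm f g := le_antisymm (skorokhodEDist_comm_le f g) (skorokhodEDist_comm_le g f)
  edist_triangle f g h := by
    refine ENNReal.le_of_forall_pos_le_add fun ε hε hlt => ?_
    have hfg : skorokhodEDist f g ≠ ⊤ := fun h => by simp [h] at hlt
    have hgh : skorokhodEDist g h ≠ ⊤ := fun h => by simp [h] at hlt
    have hε' : ((ε / 2 : NNReal) : ℝ≥0∞) ≠ 0 := by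
      simpa using hε.ne'
    obtain ⟨l₁, h₁⟩ := iInf_lt_iff.1 (ENNReal.lt_add_right hfg hε')
    obtain ⟨l₂, h₂⟩ := iInf_lt_iff.1 (ENNReal.lt_add_right hgh hε')
    have hsum : skorokhodEDist f g + skorokhodEDist g h + ε
        = (skorokhodEDist f g + (ε / 2 : NNReal)) + (skorokhodEDist g h + (ε / 2 : NNReal)) := by
      rw [add_add_add_comm, ← ENNReal.coe_add, add_halves]
    rw [max_lt_iff] at h₁ h₂
    rw [hsum]
    refine (iInf_le _ (l₁.trans l₂)).trans (max_le ?_ ?_)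
    · refine iSup_le fun t => ?_
      calc edist ((l₁.trans l₂) t) t ≤ edist (l₂ (l₁ t)) (l₁ t) + edist (l₁ t) t :=
            edist_triangle _ _ _
        _ ≤ _ := by
            rw [add_comm]
            exact add_le_add
              ((le_iSup (fun t : I => edist (l₁ t) t) t).trans h₁.1.le)
              ((le_iSup (fun t : I => edist (l₂ t) t) (l₁ t)).trans h₂.1.le)
    · refine iSup_le fun t => ?_
      calc edist (f t) (h ((l₁.trans l₂) t))
            ≤ edist (f t) (g (l₁ t)) + edist (g (l₁ t)) (h (l₂ (l₁ t))) :=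
            edist_triangle _ _ _
        _ ≤ _ := add_le_add
              ((le_iSup (fun t : I => edist (f t) (g (l₁ t))) t).trans h₁.2.le)
              ((le_iSup (fun t : I => edist (g t) (h (l₂ t))) (l₁ t)).trans h₂.2.le)

end SkorokhodD

/-- The space `D(0,1) × D(0,1)`, with the product of the Skorokhod topologies and the Borel
σ-algebra of that product. -/
def SkorokhodPair : Type := SkorokhodD × SkorokhodD

namespace SkorokhodPair

/-- The pair `(f, g)` as an element of `D(0,1) × D(0,1)`. -/
def mk (f g : SkorokhodD) : SkorokhodPair := (f, g)

instance : TopologicalSpace SkorokhodPair :=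
  inferInstanceAs (TopologicalSpace (SkorokhodD × SkorokhodD))

instance : MeasurableSpace SkorokhodPair := borel SkorokhodPair

instance : BorelSpace SkorokhodPair := ⟨rfl⟩

end SkorokhodPair

/-- `T : D(0,1) → [0,1]` is Hadamard differentiable at `G`, tangentially to `C(0,1)`, with
derivative the continuous linear form `T'` on `C(0,1)`: `(T (G + t h_t) - T G) / t → T' H` as
`t ↓ 0`, whenever `h_t ∈ D(0,1)` converges uniformly to `H ∈ C(0,1)`. -/
def HasHadamardDerivTangentially (T : SkorokhodD → I) (T' : C(I, ℝ) →L[ℝ] ℝ)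
    (G : SkorokhodD) : Prop :=
  ∀ (t : ℕ → ℝ) (h : ℕ → SkorokhodD) (H : C(I, ℝ)),
    (∀ n, 0 < t n) → Tendsto t atTop (𝓝 0) →
    TendstoUniformly (fun n (x : I) => h n x) (fun x => H x) atTop →
    Tendsto (fun n => (((T (G + t n • h n) : I) : ℝ) - ((T G : I) : ℝ)) / t n) atTop (𝓝 (T' H))

/-! ### The limiting cumulative distribution functions -/

/-- The standard Gaussian upper-tail function `Φ(z) = P(Z ≥ z)`. -/
def gaussianTail (z : ℝ) : ℝ := (gaussianReal 0 1).real (Ici z)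

/-- The inverse of the bijection `Φ : ℝ → (0,1)` (used on `(0,1)` only). -/
def gaussianTailInv : ℝ → ℝ := Function.invFun gaussianTail

/-- `G₁(t) = Φ(Φ⁻¹(t) - μ)`, the c.d.f. of the p-values under the alternative, with
`G₁(0) = 0` and `G₁(1) = 1`. -/
def altCDF (μ t : ℝ) : ℝ :=
  if t ≤ 0 then 0 else if 1 ≤ t then 1 else gaussianTail (gaussianTailInv t - μ)

/-- `G(t) = π₀ G₀(t) + (1 - π₀) G₁(t)` with `G₀(t) = t`. -/
def mixCDF (π₀ μ t : ℝ) : ℝ := π₀ * t + (1 - π₀) * altCDF μ t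

/-- `q(t) = π₀ t / G(t)`. -/
def qFun (π₀ μ t : ℝ) : ℝ := π₀ * t / mixCDF π₀ μ t

theorem gaussianTail_strictAnti : StrictAnti gaussianTail := by
  intro a b hab
  have hpos : 0 < (gaussianReal 0 1).real (Ico a b) := by
    rw [measureReal_def, ENNReal.toReal_pos_iff]
    refine ⟨pos_iff_ne_zero.2 fun h0 => ?_, measure_lt_top _ _⟩
    have := gaussianReal_absolutelyContinuous' 0 one_ne_zero h0
    rw [Real.volume_Ico] at this
    simp only [ENNReal.ofReal_eq_zero] at this
    linarith
  have hd : gaussianTail a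
      = (gaussianReal 0 1).real (Ico a b) + (gaussianReal 0 1).real (Ici b) := by
    rw [gaussianTail, ← Ico_union_Ici_eq_Ici hab.le]
    exact measureReal_union (Set.disjoint_left.2 fun x hx hx' => not_lt.2 hx' hx.2)
      measurableSet_Ici
  rw [hd, gaussianTail]
  linarith

theorem gaussianReal_std_singleton (x : ℝ) : gaussianReal 0 1 {x} = 0 :=
  gaussianReal_absolutelyContinuous 0 one_ne_zero Real.volume_singleton

theorem gaussianTail_eq (z : ℝ) : gaussianTail z = 1 - cdf (gaussianReal 0 1) z := by
  rw [cdf_eq_real, ← probReal_compl_eq_one_sub measurableSet_Iic, compl_Iic, gaussianTail,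
    measureReal_def, measureReal_def, ← Ioi_union_left]
  congr 1
  refine le_antisymm ((measure_union_le _ _).trans ?_) (measure_mono subset_union_left)
  rw [gaussianReal_std_singleton, add_zero]

theorem gaussianTail_continuous : Continuous gaussianTail := by
  have hc : Continuous (cdf (gaussianReal 0 1)) := by
    refine continuous_iff_continuousAt.2 fun x => ?_
    rw [(monotone_cdf (gaussianReal 0 1)).continuousAt_iff_leftLim_eq_rightLim,
      StieltjesFunction.rightLim_eq]
    have h := (cdf (gaussianReal 0 1)).measure_singleton x
    rw [measure_cdf, gaussianReal_std_singleton, eq_comm, ENNReal.ofReal_eq_zero] at h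
    exact le_antisymm ((monotone_cdf (gaussianReal 0 1)).leftLim_le le_rfl) (by linarith)
  have : gaussianTail = fun z => 1 - cdf (gaussianReal 0 1) z := funext gaussianTail_eq
  rw [this]
  exact continuous_const.sub hc

theorem gaussianTail_tendsto_atTop : Tendsto gaussianTail atTop (𝓝 0) := by
  have := (tendsto_cdf_atTop (gaussianReal 0 1)).const_sub 1
  rw [sub_self] at this
  exact this.congr fun z => (gaussianTail_eq z).symm

theorem gaussianTail_tendsto_atBot : Tendsto gaussianTail atBot (𝓝 1) := by
  have := (tendsto_cdf_atBot (gaussianReal 0 1)).const_sub 1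
  rw [sub_zero] at this
  exact this.congr fun z => (gaussianTail_eq z).symm

theorem gaussianTail_pos (z : ℝ) : 0 < gaussianTail z :=
  lt_of_le_of_lt measureReal_nonneg (gaussianTail_strictAnti (lt_add_one z))

theorem gaussianTail_lt_one (z : ℝ) : gaussianTail z < 1 :=
  lt_of_lt_of_le (gaussianTail_strictAnti (sub_one_lt z)) measureReal_le_one

theorem gaussianTail_gaussianTailInv {t : ℝ} (h0 : 0 < t) (h1 : t < 1) :
    gaussianTail (gaussianTailInv t) = t := by
  refine Function.invFun_eq ?_
  obtain ⟨a, ha⟩ := (gaussianTail_tendsto_atTop.eventually (gt_mem_nhds h0)).exists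
  obtain ⟨b, hb⟩ := (gaussianTail_tendsto_atBot.eventually (lt_mem_nhds h1)).exists
  exact mem_range_of_exists_le_of_exists_ge gaussianTail_continuous ⟨a, ha.le⟩ ⟨b, hb.le⟩

theorem gaussianTailInv_gaussianTail (z : ℝ) : gaussianTailInv (gaussianTail z) = z :=
  Function.leftInverse_invFun gaussianTail_strictAnti.injective z

theorem altCDF_mem (μ t : ℝ) : altCDF μ t ∈ I := by
  unfold altCDF
  split_ifs
  · exact ⟨le_rfl, zero_le_one⟩
  · exact ⟨zero_le_one, le_rfl⟩
  · exact ⟨(gaussianTail_pos _).le, (gaussianTail_lt_one _).le⟩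

theorem altCDF_monotone (μ : ℝ) : Monotone (altCDF μ) := by
  intro s t hst
  have hs := altCDF_mem μ s
  have ht := altCDF_mem μ t
  by_cases h0 : s ≤ 0
  · have : altCDF μ s = 0 := if_pos h0
    rw [this]; exact ht.1
  by_cases h1 : 1 ≤ t
  · have : altCDF μ t = 1 := by
      rw [altCDF, if_neg (by linarith), if_pos h1]
    rw [this]; exact hs.2
  push Not at h0 h1
  rw [altCDF, altCDF, if_neg (by linarith), if_neg (by linarith), if_neg (by linarith),
    if_neg (by linarith)]
  refine gaussianTail_strictAnti.antitone (sub_le_sub_right ?_ μ)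
  rw [← gaussianTail_strictAnti.le_iff_ge, gaussianTail_gaussianTailInv h0 (by linarith),
    gaussianTail_gaussianTailInv (by linarith) h1]
  exact hst

theorem altCDF_continuous (μ : ℝ) : Continuous fun t : I => altCDF μ t := by
  let g : I → I := fun t => ⟨altCDF μ t, altCDF_mem μ t⟩
  have hg : Monotone g := fun s t hst => altCDF_monotone μ hst
  have hs : Function.Surjective g := by
    rintro ⟨s, hs0, hs1⟩
    rcases hs0.eq_or_lt with rfl | hs0
    · exact ⟨0, Subtype.ext (if_pos le_rfl)⟩
    rcases hs1.eq_or_lt with rfl | hs1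
    · refine ⟨1, Subtype.ext ?_⟩
      change altCDF μ 1 = 1
      rw [altCDF, if_neg (by norm_num), if_pos le_rfl]
    · have hp := gaussianTail_pos (gaussianTailInv s + μ)
      have hl := gaussianTail_lt_one (gaussianTailInv s + μ)
      refine ⟨⟨gaussianTail (gaussianTailInv s + μ), hp.le, hl.le⟩, Subtype.ext ?_⟩
      change altCDF μ (gaussianTail (gaussianTailInv s + μ)) = s
      rw [altCDF, if_neg (by linarith), if_neg (by linarith), gaussianTailInv_gaussianTail,
        add_sub_cancel_right, gaussianTail_gaussianTailInv hs0 hs1]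
  exact continuous_subtype_val.comp (hg.continuous_of_surjective hs)

/-- `G₀` as an element of `D(0,1)`. -/
def G0D : SkorokhodD := SkorokhodD.ofContinuous ⟨fun t => (t : ℝ), continuous_subtype_val⟩

/-- `G₁` as an element of `D(0,1)`. -/
def G1D (μ : ℝ) : SkorokhodD := SkorokhodD.ofContinuous ⟨fun t => altCDF μ t, altCDF_continuous μ⟩

/-- `G = π₀ G₀ + (1 - π₀) G₁` as an element of `D(0,1)`. -/
def GD (π₀ μ : ℝ) : SkorokhodD := π₀ • G0D + (1 - π₀) • G1D μ

/-! ### Empirical distribution functions and false discovery proportion -/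

theorem isCadlag_step (p : ℝ) : IsCadlag fun t : I => if p ≤ t then (1 : ℝ) else 0 := by
  intro t
  constructor
  · by_cases h : p ≤ t
    · have hc : ContinuousWithinAt (fun _ : I => (1 : ℝ)) (Ici t) t := continuousWithinAt_const
      refine hc.congr (fun y hy => ?_) ?_
      · have hy' : (t : ℝ) ≤ y := hy
        exact if_pos (h.trans hy')
      · exact if_pos h
    · have hev : (fun t : I => if p ≤ t then (1 : ℝ) else 0) =ᶠ[𝓝 t] fun _ => 0 := by
        have : ∀ᶠ y : I in 𝓝 t, (y : ℝ) < p :=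
          continuous_subtype_val.continuousAt.eventually (gt_mem_nhds (not_le.1 h))
        filter_upwards [this] with y hy using if_neg (not_le.2 hy)
      exact (continuousAt_const.congr hev.symm).continuousWithinAt
  · have hm : Monotone fun t : I => if p ≤ t then (1 : ℝ) else 0 := by
      intro s t hst
      have hst' : (s : ℝ) ≤ t := hst
      dsimp only
      split_ifs
      · exact le_rfl
      · linarith
      · exact zero_le_one
      · exact le_rfl
    exact ⟨_, hm.tendsto_leftLim t⟩

/-- The function `t ↦ 1{p ≤ t}` in `D(0,1)`. -/
def stepD (p : ℝ) : SkorokhodD :=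
  SkorokhodD.mk (fun t : I => if p ≤ t then (1 : ℝ) else 0) (isCadlag_step p)

/-- The number of true nulls `m₀ = |{i | τ_i = 0}|`. -/
def numNull {m : ℕ} (τ : Fin m → ℝ) : ℕ := (Finset.univ.filter fun i => τ i = 0).card

/-- The p-values `p_i = Φ(X_i)`. -/
def pValue {m : ℕ} (X : Fin m → ℝ) (i : Fin m) : ℝ := gaussianTail (X i)

/-- The e.c.d.f. `Ĝ_{0,m}(t) = m₀⁻¹ ∑_{i : τ_i = 0} 1{p_i ≤ t}` of the p-values under the null. -/
def ecdfNull {m : ℕ} (τ p : Fin m → ℝ) : SkorokhodD :=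
  (numNull τ : ℝ)⁻¹ • ∑ i ∈ Finset.univ.filter (fun i => τ i = 0), stepD (p i)

/-- The e.c.d.f. `Ĝ_{1,m}(t) = (m - m₀)⁻¹ ∑_{i : τ_i > 0} 1{p_i ≤ t}` of the p-values under the
alternative. -/
def ecdfAlt {m : ℕ} (τ p : Fin m → ℝ) : SkorokhodD :=
  ((m : ℝ) - numNull τ)⁻¹ • ∑ i ∈ Finset.univ.filter (fun i => 0 < τ i), stepD (p i)

/-- The e.c.d.f. `Ĝ_m(t) = m⁻¹ ∑_i 1{p_i ≤ t}` of all p-values. -/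
def ecdf {m : ℕ} (p : Fin m → ℝ) : SkorokhodD := (m : ℝ)⁻¹ • ∑ i, stepD (p i)

/-- The false discovery proportion at the threshold `t`,
`FDP_m(t) = |{i | τ_i = 0, p_i ≤ t}| / (|{i | p_i ≤ t}| ∨ 1)`. -/
def FDP {m : ℕ} (τ p : Fin m → ℝ) (t : ℝ) : ℝ :=
  ((Finset.univ.filter fun i => τ i = 0 ∧ p i ≤ t).card : ℝ) /
    (max (Finset.univ.filter fun i => p i ≤ t).card 1 : ℕ)

/-! ### The linear forms `ζ₀`, `ζ₁` -/

/-- The derivative of `q` at `t` (relative to `[0,1]`, hence one-sided if `t = 1`). -/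
def qDeriv (π₀ μ t : ℝ) : ℝ := derivWithin (qFun π₀ μ) (Icc 0 1) t

/-- `ζ₀ = (q(t⋆)(1 - q(t⋆)) / t⋆) δ_{t⋆} + q'(t⋆) π₀ T'`. -/
def zeta0 (π₀ μ : ℝ) (s : I) (T' : C(I, ℝ) →L[ℝ] ℝ) : C(I, ℝ) →L[ℝ] ℝ :=
  (qFun π₀ μ s * (1 - qFun π₀ μ s) / s) • ContinuousMap.evalCLM ℝ s + (qDeriv π₀ μ s * π₀) • T'

/-- `ζ₁ = -(q(t⋆)(1 - q(t⋆)) / G₁(t⋆)) δ_{t⋆} + q'(t⋆) (1 - π₀) T'`. -/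
def zeta1 (π₀ μ : ℝ) (s : I) (T' : C(I, ℝ) →L[ℝ] ℝ) : C(I, ℝ) →L[ℝ] ℝ :=
  (-(qFun π₀ μ s * (1 - qFun π₀ μ s) / altCDF μ s)) • ContinuousMap.evalCLM ℝ s +
    (qDeriv π₀ μ s * (1 - π₀)) • T'

end

/-! Write ρ = m₀/m and let t̂ be the random threshold `T (ecdf p)`. As soon as ρ > 0, the FDP at t̂
is exactly ρu / (ρu + (1-ρ)v), where u and v are the null and alternative e.c.d.f.s at t̂ and ρ < 1.
The result is thus a delta method, done first for deterministic sequences and then transferred to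
laws.

Deterministic part (`tendsto_mul_FDP_sub_qFun`): suppose the rescaled empirical processes converge
uniformly to continuous w₀, w₁. Hadamard differentiability expands t̂ around t⋆, so t̂ → t⋆ and the
processes evaluated at t̂ converge to w₀(t⋆), w₁(t⋆). The error of the ratio around q(t̂) gives the
point masses of ζ₀, ζ₁; the error q(t̂) - q(t⋆) gives the q' terms (`tendsto_mul_ratio_sub_qFun`).
The latter needs q differentiable up to t⋆ = 1, which holds because G₁ has derivative 0 there.

Transfer: J1 convergence to a continuous limit is uniform convergence
(`SkorokhodD.tendsto_ofContinuous_iff`), so the deterministic statement is the hypothesis of an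
extended continuous mapping theorem. That theorem comes from the closed-set portmanteau criterion,
with no almost sure representation. -/

/-! ### Continuous mapping -/

/-- A function continuous for the topology induced by an a.e. measurable map is a.e. measurable. -/
theorem aemeasurable_of_tendsto_comap {E Ω' : Type*} [TopologicalSpace E] [MeasurableSpace E]
    [OpensMeasurableSpace E] [MeasurableSpace Ω'] {μ' : Measure Ω'} {Z : Ω' → E} {g : Ω' → ℝ}
    (hZ : AEMeasurable Z μ') (hg : ∀ ω, Tendsto g (comap Z (𝓝 (Z ω))) (𝓝 (g ω))) :
    AEMeasurable g μ' := by
  have hcont : @Continuous Ω' ℝ (TopologicalSpace.induced Z ‹_›) _ g := by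
    let := TopologicalSpace.induced Z ‹_›
    refine continuous_iff_continuousAt.2 fun ω => ?_
    rw [ContinuousAt, nhds_induced]
    exact hg ω
  have hnull : NullMeasurable g μ' := by
    -- A closed set pulls back under g to Z⁻¹(K) with K closed; since Z is only a.e. measurable,
    -- this set is only null measurable.
    refine @measurable_of_isClosed ℝ (NullMeasurableSpace Ω' μ') _ _ _ _ g fun F hF => ?_
    obtain ⟨K, hK, hKF⟩ := isClosed_induced_iff.1 (@IsClosed.preimage _ _
      (TopologicalSpace.induced Z ‹_›) _ g hcont F hF)
    have h := hZ.nullMeasurable hK.measurableSet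
    rwa [hKF] at h
  exact hnull.aemeasurable

/-- **Extended continuous mapping theorem**: if `X i` tends to `Z` in distribution, and
`g i (ω i)` tends to `g' ω'` whenever `X i (ω i)` tends to `Z ω'`, then `g i` tends to `g'` in
distribution. -/
theorem MeasureTheory.TendstoInDistribution.of_tendsto_comap {E Ω' : Type*} {Ω : ℕ → Type*}
    [TopologicalSpace E] [HasOuterApproxClosed E] [MeasurableSpace E] [OpensMeasurableSpace E]
    [∀ i, MeasurableSpace (Ω i)] {P : ∀ i, Measure (Ω i)} [∀ i, IsProbabilityMeasure (P i)]
    [MeasurableSpace Ω'] {P' : Measure Ω'} [IsProbabilityMeasure P']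
    {X : ∀ i, Ω i → E} {Z : Ω' → E} (h : TendstoInDistribution X atTop Z P P')
    {g : ∀ i, Ω i → ℝ} {g' : Ω' → ℝ} (hg : ∀ i, AEMeasurable (g i) (P i))
    (hg' : AEMeasurable g' P')
    (hlim : ∀ ω', Tendsto (fun x : Σ i, Ω i => g x.1 x.2)
      (comap (fun x : Σ i, Ω i => x.1) atTop ⊓ comap (fun x : Σ i, Ω i => X x.1 x.2) (𝓝 (Z ω')))
      (𝓝 (g' ω'))) :
    TendstoInDistribution g atTop g' P P' where
  forall_aemeasurable := hg
  aemeasurable_limit := hg'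
  tendsto := by
    refine tendsto_of_forall_isClosed_limsup_le' fun F hF => ?_
    -- For i ≥ k, the event g i ∈ F is contained in X i ∈ A k. The portmanteau bound applies for
    -- fixed k, and k → ∞ is taken afterwards, under the law of Z.
    set A : ℕ → Set E := fun k =>
      closure ((fun x : Σ i, Ω i => X x.1 x.2) '' {x | k ≤ x.1 ∧ g x.1 x.2 ∈ F}) with hA
    have hAc : ∀ k, IsClosed (A k) := fun k => isClosed_closure
    have hAanti : Antitone A := fun k l hkl =>
      closure_mono (image_mono fun x hx => ⟨hkl.trans hx.1, hx.2⟩)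
    -- If Z ω' lies in every A k, points with arbitrarily large index and X arbitrarily close to Z
    -- ω' have g in F; so the limit g' ω' is in the closed set F.
    have hsub : Z ⁻¹' (⋂ k, A k) ⊆ g' ⁻¹' F := by
      intro ω' hω'
      refine hF.mem_of_frequently_of_tendsto ?_ (hlim ω')
      have hb := ((atTop_basis (α := ℕ)).comap (fun x : Σ i, Ω i => x.1)).inf
        ((𝓝 (Z ω')).basis_sets.comap (fun x : Σ i, Ω i => X x.1 x.2))
      rw [hb.frequently_iff]
      rintro ⟨k, U⟩ ⟨-, hU⟩
      obtain ⟨y, hyU, x, ⟨hkx, hxF⟩, rfl⟩ := mem_closure_iff_nhds.1 (mem_iInter.1 hω' k) U hU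
      exact ⟨x, ⟨hkx, hyU⟩, hxF⟩
    have hbound : ∀ k, atTop.limsup (fun i => (P i).map (g i) F) ≤ P'.map Z (A k) := by
      intro k
      refine le_trans ?_ (ProbabilityMeasure.limsup_measure_closed_le_of_tendsto h.tendsto (hAc k))
      refine limsup_le_limsup ?_
      filter_upwards [eventually_ge_atTop k] with i hi
      rw [Measure.map_apply_of_aemeasurable (hg i) hF.measurableSet]
      change _ ≤ (P i).map (X i) (A k)
      rw [Measure.map_apply_of_aemeasurable (h.forall_aemeasurable i) (hAc k).measurableSet]
      exact measure_mono fun ω hω => subset_closure ⟨⟨i, ω⟩, ⟨hi, hω⟩, rfl⟩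
    have hZp : IsProbabilityMeasure (P'.map Z) :=
      Measure.isProbabilityMeasure_map h.aemeasurable_limit
    have hT : Tendsto (fun k => P'.map Z (A k)) atTop (𝓝 (P'.map Z (⋂ k, A k))) :=
      tendsto_measure_iInter_atTop (fun k => (hAc k).measurableSet.nullMeasurableSet) hAanti
        ⟨0, measure_ne_top _ _⟩
    refine (ge_of_tendsto' hT hbound).trans ?_
    change _ ≤ P'.map g' F
    rw [Measure.map_apply_of_aemeasurable h.aemeasurable_limit
      (isClosed_iInter hAc).measurableSet, Measure.map_apply_of_aemeasurable hg' hF.measurableSet]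
    exact measure_mono hsub

/-! ### Skorokhod convergence to a continuous function -/

theorem SkorokhodD.edist_def (f g : SkorokhodD) : edist f g =
    ⨅ lam : I ≃o I, max (⨆ t : I, edist (lam t) t) (⨆ t : I, edist (f t) (g (lam t))) := rfl

theorem SkorokhodD.edist_le_iSup (f g : SkorokhodD) : edist f g ≤ ⨆ t : I, edist (f t) (g t) := by
  rw [edist_def]
  refine (iInf_le _ (OrderIso.refl I)).trans ?_
  simp

/-- Skorokhod convergence to a continuous function is uniform convergence. -/
theorem SkorokhodD.tendsto_ofContinuous_iff {ι : Type*} {l : Filter ι} {F : ι → SkorokhodD}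
    {w : C(I, ℝ)} : Tendsto F l (𝓝 (SkorokhodD.ofContinuous w)) ↔
      TendstoUniformly (fun i (t : I) => F i t) (fun t => w t) l := by
  constructor
  · intro h
    rw [Metric.tendstoUniformly_iff]
    intro ε hε
    -- Uniform continuity of w absorbs the time change: a shift below δ moves w by less than ε / 2.
    obtain ⟨δ, hδ, hw⟩ := Metric.uniformContinuous_iff.1
      (CompactSpace.uniformContinuous_of_continuous w.continuous) (ε / 2) (half_pos hε)
    have hη : 0 < min δ (ε / 2) := lt_min hδ (half_pos hε)
    filter_upwards [EMetric.tendsto_nhds.1 h (ENNReal.ofReal (min δ (ε / 2)))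
      (ENNReal.ofReal_pos.2 hη)] with i hi t
    rw [edist_def] at hi
    obtain ⟨lam, hlam⟩ := iInf_lt_iff.1 hi
    rw [max_lt_iff] at hlam
    have h1 := (le_iSup (fun t : I => edist (lam t) t) t).trans_lt hlam.1
    have h2 := (le_iSup (fun t : I => edist (F i t) (ofContinuous w (lam t))) t).trans_lt hlam.2
    rw [edist_dist, ENNReal.ofReal_lt_ofReal_iff hη, lt_min_iff] at h1 h2
    have h3 := hw h1.1
    calc dist (w t) (F i t) ≤ dist (w (lam t)) (w t) + dist (F i t) (w (lam t)) := by
          rw [dist_comm (w (lam t)), dist_comm (F i t)]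
          exact dist_triangle _ _ _
      _ < ε / 2 + ε / 2 := add_lt_add h3 h2.2
      _ = ε := add_halves ε
  · intro h
    rw [Metric.tendstoUniformly_iff] at h
    rw [EMetric.tendsto_nhds]
    intro ε hε
    obtain ⟨δ, hδ0, hδ⟩ := ENNReal.lt_iff_exists_real_btwn.1 hε
    have hδ1 : 0 < δ := ENNReal.ofReal_pos.1 hδ.1
    filter_upwards [h δ hδ1] with i hi
    refine ((edist_le_iSup _ _).trans (iSup_le fun t => ?_)).trans_lt hδ.2
    rw [edist_dist, dist_comm]
    exact ENNReal.ofReal_le_ofReal (hi t).le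

namespace SkorokhodPair

instance : TopologicalSpace.PseudoMetrizableSpace SkorokhodPair :=
  inferInstanceAs (TopologicalSpace.PseudoMetrizableSpace (SkorokhodD × SkorokhodD))

theorem tendsto_mk_ofContinuous_iff {ι : Type*} {l : Filter ι} {F G : ι → SkorokhodD}
    {v w : C(I, ℝ)} :
    Tendsto (fun i => mk (F i) (G i)) l
      (𝓝 (mk (SkorokhodD.ofContinuous v) (SkorokhodD.ofContinuous w))) ↔
    TendstoUniformly (fun i (t : I) => F i t) (fun t => v t) l ∧
      TendstoUniformly (fun i (t : I) => G i t) (fun t => w t) l := by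
  rw [← SkorokhodD.tendsto_ofContinuous_iff, ← SkorokhodD.tendsto_ofContinuous_iff]
  exact Prod.tendsto_iff (seq := fun i => ((F i, G i) : SkorokhodD × SkorokhodD))
    (SkorokhodD.ofContinuous v, SkorokhodD.ofContinuous w)

end SkorokhodPair

/-! ### Differentiability of the limiting c.d.f.s -/

theorem gaussianTail_eq_integral (z : ℝ) :
    gaussianTail z = ∫ x in Ioi z, gaussianPDFReal 0 1 x := by
  rw [gaussianTail, measureReal_def, gaussianReal_apply_eq_integral 0 one_ne_zero,
    ENNReal.toReal_ofReal (integral_nonneg fun x => gaussianPDFReal_nonneg _ _ _),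
    integral_Ici_eq_integral_Ioi]

theorem continuous_gaussianPDFReal_std : Continuous (gaussianPDFReal 0 1) := by
  unfold gaussianPDFReal
  fun_prop

theorem hasDerivAt_gaussianTail (z : ℝ) : HasDerivAt gaussianTail (-gaussianPDFReal 0 1 z) z := by
  have hc := continuous_gaussianPDFReal_std
  have hi := integrable_gaussianPDFReal 0 1
  have h : gaussianTail = fun y => gaussianTail 0 - ∫ x in (0 : ℝ)..y, gaussianPDFReal 0 1 x := by
    funext y
    rw [gaussianTail_eq_integral, gaussianTail_eq_integral,
      ← intervalIntegral.integral_Ioi_sub_Ioi' hi.integrableOn hi.integrableOn]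
    ring
  rw [h]
  exact (intervalIntegral.integral_hasDerivAt_right (hc.intervalIntegrable _ _)
    (hc.stronglyMeasurableAtFilter _ _) hc.continuousAt).const_sub _

theorem gaussianTailInv_lt_iff {t b : ℝ} (h0 : 0 < t) (h1 : t < 1) :
    gaussianTailInv t < b ↔ gaussianTail b < t := by
  rw [← gaussianTail_strictAnti.lt_iff_gt, gaussianTail_gaussianTailInv h0 h1]

/-- A strictly monotone function whose image is a neighbourhood of its value is continuous; the sign
change makes the inverse increasing. -/
theorem continuousAt_gaussianTailInv {t : ℝ} (h0 : 0 < t) (h1 : t < 1) :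
    ContinuousAt gaussianTailInv t := by
  have hm : StrictMonoOn (fun t => -gaussianTailInv t) (Ioo 0 1) := by
    intro s hs u hu hsu
    rw [neg_lt_neg_iff, gaussianTailInv_lt_iff hu.1 hu.2, gaussianTail_gaussianTailInv hs.1 hs.2]
    exact hsu
  have hc : ContinuousAt (fun t => -gaussianTailInv t) t := by
    refine hm.continuousAt_of_image_mem_nhds (Ioo_mem_nhds h0 h1) ?_
    refine mem_of_superset univ_mem fun y _ => ?_
    exact ⟨gaussianTail (-y), ⟨gaussianTail_pos _, gaussianTail_lt_one _⟩, by
      beta_reduce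
      rw [gaussianTailInv_gaussianTail, neg_neg]⟩
  exact hc.neg.congr (Eventually.of_forall fun s => neg_neg _)

/-- The derivative is the likelihood ratio φ(x - μ) / φ(x) at x = Φ⁻¹(t), by the chain rule and the
inverse function rule. -/
theorem hasDerivAt_altCDF (μ : ℝ) {t : ℝ} (h0 : 0 < t) (h1 : t < 1) :
    HasDerivAt (altCDF μ) (Real.exp (μ * gaussianTailInv t - μ ^ 2 / 2)) t := by
  have hpos := gaussianPDFReal_pos 0 1 (gaussianTailInv t) one_ne_zero
  have hinv : HasDerivAt gaussianTailInv (-gaussianPDFReal 0 1 (gaussianTailInv t))⁻¹ t := by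
    refine (hasDerivAt_gaussianTail _).of_local_left_inverse (continuousAt_gaussianTailInv h0 h1)
      (neg_ne_zero.2 hpos.ne') ?_
    filter_upwards [Ioo_mem_nhds h0 h1] with s hs using gaussianTail_gaussianTailInv hs.1 hs.2
  have h := (hasDerivAt_gaussianTail (gaussianTailInv t - μ)).comp t (hinv.sub_const μ)
  have heq : altCDF μ =ᶠ[𝓝 t] gaussianTail ∘ fun s => gaussianTailInv s - μ := by
    filter_upwards [Ioo_mem_nhds h0 h1] with s hs
    rw [altCDF, if_neg (not_le.2 hs.1), if_neg (not_le.2 hs.2), Function.comp]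
  refine (h.congr_of_eventuallyEq heq).congr_deriv ?_
  have hratio : gaussianPDFReal 0 1 (gaussianTailInv t - μ) =
      Real.exp (μ * gaussianTailInv t - μ ^ 2 / 2) * gaussianPDFReal 0 1 (gaussianTailInv t) := by
    simp only [gaussianPDFReal]
    rw [mul_left_comm, ← Real.exp_add]
    congr 2
    push_cast
    ring
  rw [hratio, inv_neg, neg_mul_neg, mul_assoc, mul_inv_cancel₀ hpos.ne', mul_one]

theorem tendsto_gaussianTailInv_one : Tendsto gaussianTailInv (𝓝[<] 1) atBot := by
  refine tendsto_atBot.2 fun b => ?_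
  filter_upwards [Ioo_mem_nhdsLT (gaussianTail_lt_one b)] with t ht
  exact ((gaussianTailInv_lt_iff ((gaussianTail_pos b).trans ht.1) ht.2).2 ht.1).le

theorem continuousOn_altCDF (μ : ℝ) : ContinuousOn (altCDF μ) I :=
  continuousOn_iff_continuous_domRestrict.2 (altCDF_continuous μ)

/-- For `μ > 0`, the c.d.f. `G₁` is flat at `1`. -/
theorem hasDerivWithinAt_altCDF_one {μ : ℝ} (hμ : 0 < μ) :
    HasDerivWithinAt (altCDF μ) 0 (Iic 1) 1 := by
  refine hasDerivWithinAt_Iic_of_tendsto_deriv (s := Ioo 0 1)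
    (fun t ht => (hasDerivAt_altCDF μ ht.1 ht.2).differentiableAt.differentiableWithinAt)
    ((continuousOn_altCDF μ 1 ⟨zero_le_one, le_rfl⟩).mono Ioo_subset_Icc_self)
    (Ioo_mem_nhdsLT zero_lt_one) ?_
  -- As t ↑ 1, Φ⁻¹(t) → -∞, and μ > 0 makes the likelihood ratio vanish.
  have h : Tendsto (fun t => Real.exp (μ * gaussianTailInv t - μ ^ 2 / 2)) (𝓝[<] 1) (𝓝 0) :=
    Real.tendsto_exp_atBot.comp (tendsto_atBot_add_const_right _ _
      (tendsto_gaussianTailInv_one.const_mul_atBot hμ))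
  refine h.congr' ?_
  filter_upwards [Ioo_mem_nhdsLT zero_lt_one] with t ht
  exact (hasDerivAt_altCDF μ ht.1 ht.2).deriv.symm

theorem differentiableWithinAt_altCDF {μ : ℝ} (hμ : 0 < μ) {t : ℝ} (ht : 0 < t) (ht1 : t ≤ 1) :
    DifferentiableWithinAt ℝ (altCDF μ) (Icc 0 1) t := by
  rcases ht1.eq_or_lt with rfl | h1
  · exact (hasDerivWithinAt_altCDF_one hμ).differentiableWithinAt.mono Icc_subset_Iic_self
  · exact (hasDerivAt_altCDF μ ht h1).differentiableAt.differentiableWithinAt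

theorem altCDF_pos (μ : ℝ) {t : ℝ} (ht : 0 < t) : 0 < altCDF μ t := by
  rw [altCDF, if_neg (not_le.2 ht)]
  split_ifs
  · exact one_pos
  · exact gaussianTail_pos _

theorem mixCDF_pos {π₀ : ℝ} (hπ₀ : π₀ ∈ Ioo (0 : ℝ) 1) (μ : ℝ) {t : ℝ} (ht : 0 < t) :
    0 < mixCDF π₀ μ t :=
  add_pos (mul_pos hπ₀.1 ht) (mul_pos (sub_pos.2 hπ₀.2) (altCDF_pos μ ht))

theorem hasDerivWithinAt_qFun {π₀ μ : ℝ} (hπ₀ : π₀ ∈ Ioo (0 : ℝ) 1) (hμ : 0 < μ) {t : ℝ}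
    (ht : 0 < t) (ht1 : t ≤ 1) :
    HasDerivWithinAt (qFun π₀ μ) (qDeriv π₀ μ t) (Icc 0 1) t := by
  have hid : DifferentiableWithinAt ℝ (fun s : ℝ => π₀ * s) (Icc 0 1) t :=
    (differentiableWithinAt_id).const_mul π₀
  exact (hid.div (hid.add ((differentiableWithinAt_altCDF hμ ht ht1).const_mul (1 - π₀)))
    (mixCDF_pos hπ₀ μ ht).ne').hasDerivWithinAt

/-! ### The functional delta method along sequences -/

theorem HasHadamardDerivTangentially.tendsto_mul_sub {T : SkorokhodD → I} {T' : C(I, ℝ) →L[ℝ] ℝ}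
    {G : SkorokhodD} (hT : HasHadamardDerivTangentially T T' G) {A : ℕ → ℝ}
    (hA : Tendsto A atTop atTop) {F : ℕ → SkorokhodD} {H : C(I, ℝ)}
    (hF : TendstoUniformly (fun n (x : I) => A n * (F n x - G x)) (fun x => H x) atTop) :
    Tendsto (fun n => A n * (((T (F n) : I) : ℝ) - T G)) atTop (𝓝 (T' H)) := by
  have hpos : ∀ n, 0 < max (A n) 1 := fun n => lt_max_of_lt_right one_pos
  have hmax : ∀ᶠ n in atTop, max (A n) 1 = A n := by
    filter_upwards [hA.eventually_ge_atTop 1] with n hn using max_eq_left hn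
  -- The definition wants positive step sizes for every n, while A n is positive only eventually;
  -- truncating at 1 changes finitely many terms.
  have h := hT (fun n => (max (A n) 1)⁻¹) (fun n => max (A n) 1 • (F n - G)) H
    (fun n => inv_pos.2 (hpos n)) ?_ ?_
  · refine h.congr' ?_
    filter_upwards [hmax] with n hn
    rw [smul_smul, inv_mul_cancel₀ (hpos n).ne', one_smul, add_sub_cancel, div_inv_eq_mul, hn,
      mul_comm]
  · refine (tendsto_inv_atTop_zero.comp hA).congr' ?_
    filter_upwards [hmax] with n hn
    rw [hn, Function.comp]
  · intro V hV
    filter_upwards [hmax, hF V hV] with n hn hV x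
    rw [hn]
    exact hV x

/-- Convergence at a diverging rate forces consistency. -/
theorem tendsto_of_tendsto_mul_sub {ι : Type*} {l : Filter ι} {A u : ι → ℝ} {c L : ℝ}
    (hA : Tendsto A l atTop) (h : Tendsto (fun n => A n * (u n - c)) l (𝓝 L)) :
    Tendsto u l (𝓝 c) := by
  have h1 := ((tendsto_inv_atTop_zero.comp hA).mul h).add_const c
  rw [zero_mul, zero_add] at h1
  refine h1.congr' ?_
  filter_upwards [hA.eventually_gt_atTop 0] with n hn
  rw [Function.comp, inv_mul_cancel_left₀ hn.ne', sub_add_cancel]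

theorem HasDerivWithinAt.tendsto_mul_sub {ι : Type*} {l : Filter ι} {f : ℝ → ℝ} {f' x L : ℝ}
    {s : Set ℝ} (hf : HasDerivWithinAt f f' s x) {A u : ι → ℝ} (hA : Tendsto A l atTop)
    (hu : ∀ n, u n ∈ s) (h : Tendsto (fun n => A n * (u n - x)) l (𝓝 L)) :
    Tendsto (fun n => A n * (f (u n) - f x)) l (𝓝 (f' * L)) := by
  have hd : Tendsto (fun n => u n - x) l (𝓝 0) := by
    simpa using (tendsto_of_tendsto_mul_sub hA h).sub_const x
  have := hf.hasFDerivWithinAt.lim hd (Eventually.of_forall fun n => by simpa using hu n)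
    (c := A) (v := L) h
  simpa [mul_comm] using this

/-- The expansion of the ratio `ρ u / (ρ u + (1 - ρ) v)`. -/
theorem tendsto_mul_ratio_sub_qFun {π₀ μ : ℝ} (hπ₀ : π₀ ∈ Ioo (0 : ℝ) 1) (hμ : 0 < μ)
    {s : ℝ} (hs : 0 < s) (hs1 : s ≤ 1) {A ρ t u v : ℕ → ℝ} {w₀ w₁ L : ℝ}
    (hA : Tendsto A atTop atTop) (hρ : Tendsto (fun k => A k * (ρ k - π₀)) atTop (𝓝 0))
    (htI : ∀ k, t k ∈ I) (ht : Tendsto (fun k => A k * (t k - s)) atTop (𝓝 L))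
    (hu : Tendsto (fun k => A k * (u k - t k)) atTop (𝓝 w₀))
    (hv : Tendsto (fun k => A k * (v k - altCDF μ (t k))) atTop (𝓝 w₁)) :
    Tendsto (fun k => A k * (ρ k * u k / (ρ k * u k + (1 - ρ k) * v k) - qFun π₀ μ s)) atTop
      (𝓝 ((qFun π₀ μ s * (1 - qFun π₀ μ s) / s) * w₀
        - (qFun π₀ μ s * (1 - qFun π₀ μ s) / altCDF μ s) * w₁ + qDeriv π₀ μ s * L)) := by
  have hG1 := altCDF_pos μ hs
  have hG := mixCDF_pos hπ₀ μ hs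
  have hρ' := tendsto_of_tendsto_mul_sub hA hρ
  have ht' := tendsto_of_tendsto_mul_sub hA ht
  have hg1 : Tendsto (fun k => altCDF μ (t k)) atTop (𝓝 (altCDF μ s)) :=
    (continuousOn_altCDF μ s ⟨hs.le, hs1⟩).tendsto.comp
      (tendsto_nhdsWithin_iff.2 ⟨ht', Eventually.of_forall htI⟩)
  have hg : Tendsto (fun k => mixCDF π₀ μ (t k)) atTop (𝓝 (mixCDF π₀ μ s)) :=
    (ht'.const_mul π₀).add (hg1.const_mul (1 - π₀))
  have hn : Tendsto (fun k => A k * (ρ k * u k - π₀ * t k)) atTop (𝓝 (π₀ * w₀)) := by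
    -- ρu - π₀t = ρ(u - t) + t(ρ - π₀), and the last term is negligible at rate A.
    have := (hρ'.mul hu).add (ht'.mul hρ)
    rw [mul_zero, add_zero] at this
    exact this.congr fun k => by ring
  have hd : Tendsto (fun k => A k * (ρ k * u k + (1 - ρ k) * v k - mixCDF π₀ μ (t k))) atTop
      (𝓝 (π₀ * w₀ + (1 - π₀) * w₁)) := by
    have := (hn.add ((hρ'.const_sub 1).mul hv)).add ((hg1.mul hρ).neg)
    rw [mul_zero, neg_zero, add_zero] at this
    exact this.congr fun k => by unfold mixCDF; ring
  have hD : Tendsto (fun k => ρ k * u k + (1 - ρ k) * v k) atTop (𝓝 (mixCDF π₀ μ s)) := by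
    have := (tendsto_of_tendsto_mul_sub hA (c := 0) (by simpa using hd)).add hg
    rw [zero_add] at this
    exact this.congr fun k => by ring
  have hratio : Tendsto (fun k => A k * (ρ k * u k / (ρ k * u k + (1 - ρ k) * v k)
      - qFun π₀ μ (t k))) atTop
      (𝓝 ((π₀ * w₀ * mixCDF π₀ μ s - π₀ * s * (π₀ * w₀ + (1 - π₀) * w₁)) /
        (mixCDF π₀ μ s * mixCDF π₀ μ s))) := by
    -- With limits n = π₀t, g = G(t): N/D - n/g = ((N - n)g - n(D - g)) / (Dg), valid once D and g
    -- are nonzero.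
    refine (((hn.mul hg).sub ((ht'.const_mul π₀).mul hd)).div (hD.mul hg)
      (mul_pos hG hG).ne').congr' ?_
    filter_upwards [hg.eventually_ne hG.ne', hD.eventually_ne hG.ne'] with k h1 h2
    rw [Pi.div_apply, qFun, div_sub_div _ _ h2 h1, ← mul_div_assoc]
    congr 1
    ring
  have hq := (hasDerivWithinAt_qFun hπ₀ hμ hs hs1).tendsto_mul_sub hA htI ht
  have hsum := hratio.add hq
  convert hsum using 2
  · ring
  · congr 1
    have h1 : mixCDF π₀ μ s ≠ 0 := hG.ne'
    -- This identity turns the quotient-rule coefficients into the q(1 - q) form of ζ₀ and ζ₁.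
    have hq1 : 1 - qFun π₀ μ s = (1 - π₀) * altCDF μ s / mixCDF π₀ μ s := by
      rw [qFun, one_sub_div h1]
      congr 1
      unfold mixCDF
      ring
    have e1 : qFun π₀ μ s * (1 - qFun π₀ μ s) / altCDF μ s =
        π₀ * s * (1 - π₀) / (mixCDF π₀ μ s * mixCDF π₀ μ s) := by
      rw [hq1, qFun]
      field_simp
    have e2 : qFun π₀ μ s * (1 - qFun π₀ μ s) / s =
        π₀ * (mixCDF π₀ μ s - π₀ * s) / (mixCDF π₀ μ s * mixCDF π₀ μ s) := by
      rw [qFun]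
      field_simp
    rw [e1, e2]
    ring

/-! ### Empirical distribution functions -/

theorem SkorokhodD.sum_apply {ι : Type*} (s : Finset ι) (f : ι → SkorokhodD) (t : I) :
    (∑ i ∈ s, f i) t = ∑ i ∈ s, f i t := by
  classical
  induction s using Finset.induction_on with
  | empty => simp only [Finset.sum_empty]; rfl
  | insert i s hi ih => rw [Finset.sum_insert hi, Finset.sum_insert hi, add_apply, ih]

theorem sum_stepD_apply {ι : Type*} (s : Finset ι) (p : ι → ℝ) (t : I) :
    (∑ i ∈ s, stepD (p i)) t = ((s.filter fun i => p i ≤ t).card : ℝ) := by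
  rw [SkorokhodD.sum_apply, Finset.natCast_card_filter]
  rfl

theorem ecdf_eq_add {m : ℕ} {τ : Fin m → ℝ} (hτ : ∀ i, 0 ≤ τ i) (h0 : 0 < numNull τ)
    (h1 : numNull τ < m) (p : Fin m → ℝ) :
    ecdf p = ((numNull τ : ℝ) / m) • ecdfNull τ p + (1 - (numNull τ : ℝ) / m) • ecdfAlt τ p := by
  have hm : (m : ℝ) ≠ 0 := Nat.cast_ne_zero.2 (h0.trans h1).ne'
  have h0' : (numNull τ : ℝ) ≠ 0 := Nat.cast_ne_zero.2 h0.ne'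
  have h1' : (m : ℝ) - numNull τ ≠ 0 := sub_ne_zero.2 (Nat.cast_lt.2 h1).ne'
  have hfilter : Finset.univ.filter (fun i => 0 < τ i) = Finset.univ.filter fun i => ¬ τ i = 0 :=
    Finset.filter_congr fun i _ => (hτ i).lt_iff_ne'
  rw [ecdf, ecdfNull, ecdfAlt, smul_smul, smul_smul, hfilter, one_sub_div hm, div_mul_eq_mul_div,
    div_mul_eq_mul_div, mul_inv_cancel₀ h0', mul_inv_cancel₀ h1', one_div, ← smul_add,
    Finset.sum_filter_add_sum_filter_not]

theorem FDP_eq_div {m : ℕ} {τ : Fin m → ℝ} (h0 : 0 < numNull τ) (p : Fin m → ℝ) (t : I) :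
    FDP τ p t = (numNull τ : ℝ) / m * ecdfNull τ p t / ecdf p t := by
  have hm : (m : ℝ) ≠ 0 := by
    rw [Nat.cast_ne_zero]
    rintro rfl
    exact h0.ne' rfl
  have h0' : (numNull τ : ℝ) ≠ 0 := Nat.cast_ne_zero.2 h0.ne'
  rw [ecdf, SkorokhodD.smul_apply, sum_stepD_apply, ecdfNull, SkorokhodD.smul_apply,
    sum_stepD_apply, Finset.filter_filter, FDP]
  -- With no rejection, the maximum with 1 gives 0 / 1 on the left and the convention 0 / 0 = 0
  -- applies on the right.
  rcases Nat.eq_zero_or_pos (Finset.univ.filter fun i => p i ≤ t).card with h | h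
  · have hN : (Finset.univ.filter fun i => τ i = 0 ∧ p i ≤ t).card = 0 :=
      Nat.eq_zero_of_le_zero (h ▸ Finset.card_le_card (Finset.monotone_filter_right _
        fun i _ hi => hi.2))
    simp [h, hN]
  · rw [max_eq_left (Nat.succ_le_of_lt h)]
    have hc : ((Finset.univ.filter fun i => p i ≤ t).card : ℝ) ≠ 0 := Nat.cast_ne_zero.2 h.ne'
    field_simp

/-- Joint measurability is needed because the threshold is itself random. -/
theorem measurable_FDP {m : ℕ} (τ : Fin m → ℝ) :
    Measurable fun x : (Fin m → ℝ) × ℝ => FDP τ x.1 x.2 := by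
  have hle : ∀ i, MeasurableSet {x : (Fin m → ℝ) × ℝ | x.1 i ≤ x.2} := fun i =>
    measurableSet_le ((measurable_pi_apply i).comp measurable_fst) measurable_snd
  have hcard : ∀ s : Finset (Fin m), Measurable fun x : (Fin m → ℝ) × ℝ =>
      ((s.filter fun i => x.1 i ≤ x.2).card : ℝ) := by
    intro s
    simp_rw [Finset.natCast_card_filter]
    exact Finset.measurable_sum _ fun i _ =>
      Measurable.ite (hle i) measurable_const measurable_const
  unfold FDP
  simp_rw [← Finset.filter_filter, Nat.cast_max]
  exact (hcard _).div ((hcard _).max measurable_const)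

/-! ### Asymptotics of the false discovery proportion -/

theorem tendstoUniformly_iff_tendsto_sub {ι α : Type*} {l : Filter ι} {F : ι → α → ℝ}
    {f : α → ℝ} : TendstoUniformly F f l ↔
      Tendsto (fun q : ι × α => F q.1 q.2 - f q.2) (l ×ˢ ⊤) (𝓝 0) := by
  rw [tendstoUniformly_iff_tendsto, uniformity_eq_comap_nhds_zero, tendsto_comap_iff]
  rfl

/-- cF - c₀f = c(F - f) + (c - c₀)f, where f is bounded by compactness. -/
theorem tendstoUniformly_mul_left {ι α : Type*} [TopologicalSpace α] [CompactSpace α]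
    {l : Filter ι} {F : ι → α → ℝ} {f : C(α, ℝ)} {c : ι → ℝ} {c₀ : ℝ}
    (hc : Tendsto c l (𝓝 c₀)) (hF : TendstoUniformly F f l) :
    TendstoUniformly (fun i x => c i * F i x) (fun x => c₀ * f x) l := by
  rw [tendstoUniformly_iff_tendsto_sub] at hF ⊢
  have hc' : Tendsto (fun q : ι × α => c q.1) (l ×ˢ ⊤) (𝓝 c₀) := hc.comp tendsto_fst
  have hc0 : Tendsto (fun q : ι × α => c q.1 - c₀) (l ×ˢ ⊤) (𝓝 0) := by
    simpa using hc'.sub_const c₀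
  have hb : IsBoundedUnder (· ≤ ·) (l ×ˢ ⊤) (norm ∘ fun q : ι × α => f q.2) :=
    isBoundedUnder_of ⟨‖f‖, fun q => f.norm_coe_le_norm q.2⟩
  have h := (hc'.mul hF).add (hc0.zero_mul_isBoundedUnder_le hb)
  rw [mul_zero, add_zero] at h
  exact h.congr fun q => by ring

/-- Replacing `⌊m π₀⌋ / m` by `π₀` is negligible at any rate `a = o(m)`. -/
theorem tendsto_mul_floor_div_sub {a : ℕ → ℝ} (ham : a =o[atTop] fun m => (m : ℝ)) {π₀ : ℝ}
    (hπ₀ : 0 ≤ π₀) :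
    Tendsto (fun m : ℕ => a m * ((⌊(m : ℝ) * π₀⌋₊ : ℝ) / m - π₀)) atTop (𝓝 0) := by
  refine squeeze_zero_norm' ?_ (tendsto_zero_iff_norm_tendsto_zero.1 ham.tendsto_div_nhds_zero)
  filter_upwards [eventually_gt_atTop 0] with m hm
  have hm' : (0 : ℝ) < m := Nat.cast_pos.2 hm
  rw [norm_mul, norm_div, div_eq_mul_inv ‖a m‖]
  refine mul_le_mul_of_nonneg_left ?_ (norm_nonneg _)
  have h1 := Nat.floor_le (mul_nonneg hm'.le hπ₀)
  have h2 := Nat.lt_floor_add_one ((m : ℝ) * π₀)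
  rw [div_sub' hm'.ne', norm_div, div_eq_mul_inv, Real.norm_eq_abs]
  refine mul_le_of_le_one_left (inv_nonneg.2 (norm_nonneg _)) (abs_le.2 ⟨?_, ?_⟩) <;> linarith

@[simp] theorem G0D_apply (t : I) : G0D t = t := rfl

@[simp] theorem G1D_apply (μ : ℝ) (t : I) : G1D μ t = altCDF μ t := rfl

/-- The expansion of the false discovery proportion along a sequence of realisations for which
the rescaled empirical processes converge uniformly. -/
theorem tendsto_mul_FDP_sub_qFun {π₀ μ : ℝ} (hπ₀ : π₀ ∈ Ioo (0 : ℝ) 1) (hμ : 0 < μ)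
    {T : SkorokhodD → I} {T' : C(I, ℝ) →L[ℝ] ℝ}
    (hT : HasHadamardDerivTangentially T T' (GD π₀ μ)) (htpos : 0 < T (GD π₀ μ))
    {m : ℕ → ℕ} {τ p : (k : ℕ) → Fin (m k) → ℝ} (hτ : ∀ k i, 0 ≤ τ k i) {A : ℕ → ℝ}
    (hA : Tendsto A atTop atTop)
    (hρ : Tendsto (fun k => A k * ((numNull (τ k) : ℝ) / m k - π₀)) atTop (𝓝 0))
    {w₀ w₁ : C(I, ℝ)}
    (h₀ : TendstoUniformly (fun k t => A k * (ecdfNull (τ k) (p k) t - G0D t)) w₀ atTop)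
    (h₁ : TendstoUniformly (fun k t => A k * (ecdfAlt (τ k) (p k) t - G1D μ t)) w₁ atTop) :
    Tendsto (fun k => A k * (FDP (τ k) (p k) (T (ecdf (p k))) - qFun π₀ μ (T (GD π₀ μ)))) atTop
      (𝓝 (zeta0 π₀ μ (T (GD π₀ μ)) T' w₀ + zeta1 π₀ μ (T (GD π₀ μ)) T' w₁)) := by
  set s := T (GD π₀ μ) with hs
  have hρ' := tendsto_of_tendsto_mul_sub hA hρ
  -- The null proportion tends to π₀ in (0,1), so both groups are eventually nonempty and the
  -- degenerate fractions disappear.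
  have hnum : ∀ᶠ k in atTop, 0 < numNull (τ k) ∧ numNull (τ k) < m k := by
    filter_upwards [hρ'.eventually (Ioo_mem_nhds hπ₀.1 hπ₀.2)] with k hk
    have hmk : (0 : ℝ) < m k := by
      refine (Nat.cast_nonneg _).lt_of_ne fun h => ?_
      rw [← h, div_zero] at hk
      exact hk.1.false
    exact ⟨Nat.cast_pos.1 ((div_pos_iff_of_pos_right hmk).1 hk.1),
      Nat.cast_lt.1 ((div_lt_one hmk).1 hk.2)⟩
  have hecdf : TendstoUniformly (fun k t => A k * (ecdf (p k) t - GD π₀ μ t))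
      (π₀ • w₀ + (1 - π₀) • w₁ : C(I, ℝ)) atTop := by
    have hG : TendstoUniformly (fun (_ : ℕ) (t : I) => (t : ℝ) - altCDF μ t)
        (⟨fun t : I => (t : ℝ) - altCDF μ t, continuous_subtype_val.sub (altCDF_continuous μ)⟩ :
          C(I, ℝ)) atTop :=
      fun V hV => Eventually.of_forall fun _ _ => refl_mem_uniformity hV
    -- Ĝ - G = ρ(Ĝ₀ - G₀) + (1 - ρ)(Ĝ₁ - G₁) + (ρ - π₀)(G₀ - G₁); the last term has limit 0 at rate
    -- A.
    have h := ((tendstoUniformly_mul_left hρ' h₀).add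
      (tendstoUniformly_mul_left (hρ'.const_sub 1) h₁)).add (tendstoUniformly_mul_left hρ hG)
    rw [tendstoUniformly_iff_tendsto_sub] at h ⊢
    refine h.congr' ?_
    filter_upwards [tendsto_fst.eventually hnum] with q hq
    rw [ecdf_eq_add (hτ q.1) hq.1 hq.2]
    simp only [GD, Pi.add_apply, SkorokhodD.add_apply, SkorokhodD.smul_apply, G0D_apply,
      G1D_apply, ContinuousMap.coe_mk, ContinuousMap.add_apply, ContinuousMap.smul_apply,
      smul_eq_mul]
    ring
  have ht := hT.tendsto_mul_sub hA hecdf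
  have ht' : Tendsto (fun k => T (ecdf (p k))) atTop (𝓝 s) :=
    tendsto_subtype_rng.2 (tendsto_of_tendsto_mul_sub hA ht)
  -- Uniform convergence to a continuous limit permits evaluation at the moving threshold.
  have hu := h₀.tendsto_comp w₀.continuous.continuousAt ht'
  have hv := h₁.tendsto_comp w₁.continuous.continuousAt ht'
  have key := tendsto_mul_ratio_sub_qFun hπ₀ hμ (s := s) htpos s.2.2 hA hρ
    (fun k => (T (ecdf (p k))).2) ht hu hv
  have hlim : zeta0 π₀ μ s T' w₀ + zeta1 π₀ μ s T' w₁ =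
      (qFun π₀ μ s * (1 - qFun π₀ μ s) / s) * w₀ s
        - (qFun π₀ μ s * (1 - qFun π₀ μ s) / altCDF μ s) * w₁ s
        + qDeriv π₀ μ s * T' (π₀ • w₀ + (1 - π₀) • w₁) := by
    simp only [zeta0, zeta1, map_add, map_smul, add_apply, smul_apply,
      ContinuousMap.evalCLM_apply, smul_eq_mul]
    ring
  rw [hlim]
  refine key.congr' ?_
  filter_upwards [hnum] with k hk
  rw [FDP_eq_div hk.1]
  congr 3
  exact congr_arg (fun f : SkorokhodD => f (T (ecdf (p k))))
    (ecdf_eq_add (hτ k) hk.1 hk.2 (p k)).symm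

theorem mainTheorem4
    -- the model: `X_i = τ_i + Y_i`, `τ_i ∈ {0, μ}`, with `⌊m π₀⌋` true nulls
    (π₀ μ : ℝ) (hπ₀ : π₀ ∈ Ioo (0 : ℝ) 1) (hμ : 0 < μ)
    (τ : (m : ℕ) → Fin m → ℝ) (hτ : ∀ m i, τ m i = 0 ∨ τ m i = μ)
    (hm₀ : ∀ m, numNull (τ m) = ⌊(m : ℝ) * π₀⌋₊)
    {Ω : ℕ → Type*} [∀ m, MeasurableSpace (Ω m)]
    (P : (m : ℕ) → Measure (Ω m)) [∀ m, IsProbabilityMeasure (P m)]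
    (Y : (m : ℕ) → Ω m → Fin m → ℝ) (hY : ∀ m i, Measurable fun ω => Y m ω i)
    (p : (m : ℕ) → Ω m → Fin m → ℝ) (hp : ∀ m ω, p m ω = pValue (fun i => τ m i + Y m ω i))
    -- the threshold map, which yields random thresholds
    (T : SkorokhodD → I) (T' : C(I, ℝ) →L[ℝ] ℝ)
    (hT : HasHadamardDerivTangentially T T' (GD π₀ μ))
    (hTmeas : ∀ m, AEMeasurable (fun ω => T (ecdf (p m ω))) (P m))
    (tstar : I) (htstar : tstar = T (GD π₀ μ)) (htpos : 0 < tstar)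
    -- the rate
    (a : ℕ → ℝ) (ha : Tendsto a atTop atTop) (ham : a =o[atTop] fun m => (m : ℝ))
    -- the limit processes, with continuous paths
    {Ω' : Type*} [MeasurableSpace Ω'] (P' : Measure Ω') [IsProbabilityMeasure P']
    (W₀ W₁ : Ω' → C(I, ℝ))
    (hW : TendstoInDistribution
      (fun m ω => SkorokhodPair.mk
        (a m • (ecdfNull (τ m) (p m ω) - G0D)) (a m • (ecdfAlt (τ m) (p m ω) - G1D μ)))
      atTop
      (fun ω => SkorokhodPair.mk
        (SkorokhodD.ofContinuous (W₀ ω)) (SkorokhodD.ofContinuous (W₁ ω)))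
      P P') :
    TendstoInDistribution
      (fun m ω => a m * (FDP (τ m) (p m ω) (T (ecdf (p m ω))) - qFun π₀ μ tstar))
      atTop
      (fun ω => zeta0 π₀ μ tstar T' (W₀ ω) + zeta1 π₀ μ tstar T' (W₁ ω))
      P P' := by
  subst htstar
  have hτ0 : ∀ m i, 0 ≤ τ m i := fun m i => by
    rcases hτ m i with h | h <;> rw [h]
    exact hμ.le
  -- Sequences suffice since the product space is pseudo-metrizable, which makes the filter
  -- countably generated.
  refine hW.of_tendsto_comap (fun m => ?_) ?_ fun ω' => tendsto_of_seq_tendsto fun x hx => ?_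
  · have hpm : Measurable (p m) := by
      rw [funext (hp m)]
      exact measurable_pi_lambda _ fun i =>
        gaussianTail_continuous.measurable.comp ((hY m i).const_add (τ m i))
    exact (((measurable_FDP (τ m)).comp_aemeasurable (hpm.aemeasurable.prodMk
      (measurable_subtype_coe.comp_aemeasurable (hTmeas m)))).sub_const _).const_mul _
  -- W₀ and W₁ are not assumed measurable into C(0,1). Only the pair in D × D is a.e. measurable,
  -- but its topology induces uniform convergence, for which the ζ's are continuous.
  · refine aemeasurable_of_tendsto_comap hW.aemeasurable_limit fun ω => ?_
    obtain ⟨h₀, h₁⟩ := SkorokhodPair.tendsto_mk_ofContinuous_iff.1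
      (tendsto_comap (f := fun ω => SkorokhodPair.mk
        (SkorokhodD.ofContinuous (W₀ ω)) (SkorokhodD.ofContinuous (W₁ ω))))
    exact (((zeta0 _ _ _ _).continuous.tendsto _).comp
        (ContinuousMap.tendsto_iff_tendstoUniformly.2 h₀)).add
      (((zeta1 _ _ _ _).continuous.tendsto _).comp
        (ContinuousMap.tendsto_iff_tendstoUniformly.2 h₁))
  · rw [tendsto_inf, tendsto_comap_iff, tendsto_comap_iff] at hx
    obtain ⟨h₀, h₁⟩ := SkorokhodPair.tendsto_mk_ofContinuous_iff.1 hx.2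
    have hρ := (tendsto_mul_floor_div_sub ham hπ₀.1.le).comp hx.1
    refine tendsto_mul_FDP_sub_qFun hπ₀ hμ hT htpos (fun k => hτ0 (x k).1) (ha.comp hx.1) ?_ h₀ h₁
    refine hρ.congr fun k => ?_
    simp only [Function.comp, hm₀]
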